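/- Let $q\in\mathbb C$ with $0<|q|<1$, and write $(x;q)_n=\prod_{k=0}^{n-1}(1-xq^k)$ and $(x;q)_\infty=\prod_{k=0}^{\infty}(1-xq^k)$. Let $\phi(q)=\sum_{n=-\infty}^{\infty}q^{n^2}$ and $\psi(q)=\sum_{n=0}^{\infty}q^{n(n+1)/2}$ be Ramanujan's theta functions. (i) For every $a\in\mathbb C$ with $|a|<1$, $$\frac{(q;q)_\infty^2(-a;q)_\infty}{(a;q)_\infty^2(-q;q)_\infty}=\sum_{n=0}^\infty\sum_{j=-n}^{n}(-1)^{n+j}(1-q^{2n+1})q^{n^2-j^2}\frac{(q/a;q)_n\,a^n}{(a;q)_{n+1}},$$ where $(q/a;q)_na^n$ is understood as the polynomial $\prod_{k=1}^{n}(a-q^k)$ in $a$, so that $a=0$ is allowed. (ii) (Andrews' identity) $$(q;q)_\infty^2(q;q^2)_\infty=\sum_{n=0}^\infty\sum_{j=-n}^{n}(-1)^{j}(1-q^{2n+1})q^{(3n^2+n)/2-j^2}.$$ (iii) $$\phi(q)\psi(q)=\sum_{n=0}^\infty\sum_{j=-n}^{n}(-1)^{n+j}(1+q^{2n+1})q^{2n^2+n-2j^2}.$$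 In each case the outer series over $n$ converges absolutely. -/

import Mathlib

/-- The finite `q`-shifted factorial `(a; q)_n = ∏_{k=0}^{n-1} (1 - a q^k)`. -/
noncomputable def qShifted (a q : ℂ) (n : ℕ) : ℂ :=
  ∏ k ∈ Finset.range n, (1 - a * q ^ k)

/-- The infinite `q`-shifted factorial `(a; q)_∞ = ∏_{k=0}^∞ (1 - a q^k)`. -/
noncomputable def qShiftedInf (a q : ℂ) : ℂ :=
  ∏' k : ℕ, (1 - a * q ^ k)

/-- The infinite product defining `(a; q)_∞` converges for `|q| < 1`. -/
theorem multipliable_qShiftedInf (a q : ℂ) (hq : ‖q‖ < 1) :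
    Multipliable fun k : ℕ => 1 - a * q ^ k := by
  have h : Summable fun k : ℕ => ‖-(a * q ^ k)‖ := by
    simpa [norm_mul, norm_pow] using
      (summable_geometric_of_lt_one (norm_nonneg q) hq).mul_left ‖a‖
  simpa [sub_eq_add_neg] using multipliable_one_add_of_summable h

/-- The expression `(q/a; q)_n a^n`, written as the polynomial `∏_{k=1}^{n} (a - q^k)` in `a`.
This is the literal expression for `a ≠ 0` (see `qShifted_div_mul_pow`) and its continuous
extension `(-1)^n q^{n(n+1)/2}` at `a = 0` (see `qNumer_zero`). -/
noncomputable def qNumer (a q : ℂ) (n : ℕ) : ℂ :=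
  ∏ k ∈ Finset.range n, (a - q ^ (k + 1))

theorem qShifted_div_mul_pow (a q : ℂ) (ha : a ≠ 0) (n : ℕ) :
    qShifted (q / a) q n * a ^ n = qNumer a q n := by
  induction n with
  | zero => simp [qShifted, qNumer]
  | succ n ih =>
    simp only [qShifted, qNumer] at ih ⊢
    rw [Finset.prod_range_succ, Finset.prod_range_succ, ← ih]
    field_simp
    ring

theorem qNumer_zero (q : ℂ) (n : ℕ) :
    qNumer 0 q n = (-1) ^ n * q ^ (n * (n + 1) / 2) := by
  have h : ∀ m : ℕ, (m + 1) * (m + 2) / 2 = m * (m + 1) / 2 + (m + 1) := fun m => by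
    rw [show (m + 1) * (m + 2) = m * (m + 1) + (m + 1) * 2 by ring,
      Nat.add_mul_div_right _ _ (by norm_num)]
  induction n with
  | zero => simp [qNumer]
  | succ n ih =>
    simp only [qNumer] at ih ⊢
    rw [Finset.prod_range_succ, ih, h, pow_add q, pow_succ (-1 : ℂ)]
    ring

/-- Ramanujan's theta function `φ(q) = ∑_{n=-∞}^{∞} q^{n^2}`. -/
noncomputable def ramanujanPhi (q : ℂ) : ℂ :=
  ∑' n : ℤ, q ^ (n ^ 2)

/-- Ramanujan's theta function `ψ(q) = ∑_{n=0}^{∞} q^{n(n+1)/2}`. -/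
noncomputable def ramanujanPsi (q : ℂ) : ℂ :=
  ∑' n : ℕ, q ^ (n * (n + 1) / 2)

/-- The series defining `φ(q)` converges for `|q| < 1`. -/
theorem summable_ramanujanPhi (q : ℂ) (hq : ‖q‖ < 1) :
    Summable fun n : ℤ => q ^ (n ^ 2) := by
  have h : Summable fun n : ℕ => q ^ (n ^ 2) := by
    refine Summable.of_norm_bounded (summable_geometric_of_lt_one (norm_nonneg q) hq) fun n => ?_
    rw [norm_pow]
    exact pow_le_pow_of_le_one (norm_nonneg q) hq.le (Nat.le_self_pow (by norm_num) n)
  refine Summable.of_nat_of_neg ?_ ?_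
  · exact_mod_cast h
  · simpa using (by exact_mod_cast h : Summable fun n : ℕ => q ^ ((n : ℤ) ^ 2))

/-- The series defining `ψ(q)` converges for `|q| < 1`. -/
theorem summable_ramanujanPsi (q : ℂ) (hq : ‖q‖ < 1) :
    Summable fun n : ℕ => q ^ (n * (n + 1) / 2) := by
  refine Summable.of_norm_bounded (summable_geometric_of_lt_one (norm_nonneg q) hq) fun n => ?_
  rw [norm_pow]
  refine pow_le_pow_of_le_one (norm_nonneg q) hq.le ?_
  rw [Nat.le_div_iff_mul_le (by norm_num)]
  rcases n with _ | n
  · simp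
  · gcongr; omega

/-! Fix `q`. Both sides of (i) are analytic in `a` on the unit disc, so it suffices to check them at
the points `a = q^(m+1)`, which accumulate at 0 (`hasSum_heckeTerm`). There the series stops at `n =
m`, and the claim becomes the finite identity `sum_finiteTheta_eq`.

That identity is a Bailey-pair argument relative to `q`. Put α_n = (1 - q^(2n+1)) q^(n²) ∑_{|j|≤n}
(-1)^j q^(-j²) and β_r = ∑_n α_n / ((q;q)_{r-n} (q;q)_{r+n+1}). Summation by parts and a Gauss-type
alternating sum give β_r = (-1)^r / ((q;q)_r (-q;q)_r) (`sum_mul_finiteTheta`, `gaussPartial_eq`).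
Summing β_r against the weights of `bailey_kernel`, a case of q-Chu–Vandermonde, yields the required
sum over n on one side and a q-binomial sum equal to 1 on the other.

Part (ii) is `a = 0` together with Euler's identity. Part (iii) is base `q²` with `a = q`; the
Jacobi triple product turns φ(q)ψ(q) into the theta quotient. -/

open Finset Filter Topology

/-! ### Finite q-shifted factorials and their reciprocals -/

theorem qShifted_zero (a q : ℂ) : qShifted a q 0 = 1 := by simp [qShifted]

theorem qShifted_succ (a q : ℂ) (n : ℕ) :
    qShifted a q (n + 1) = qShifted a q n * (1 - a * q ^ n) := by
  simp [qShifted, prod_range_succ]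

theorem qShifted_add (a q : ℂ) (m n : ℕ) :
    qShifted a q (m + n) = qShifted a q m * qShifted (a * q ^ m) q n := by
  simp only [qShifted, prod_range_add, pow_add, mul_assoc]

theorem qShifted_succ' (a q : ℂ) (n : ℕ) :
    qShifted a q (n + 1) = (1 - a) * qShifted (a * q) q n := by
  rw [add_comm, qShifted_add, qShifted_succ, qShifted_zero]
  simp

theorem one_sub_mul_pow_ne_zero {a q : ℂ} (ha : ‖a‖ < 1) (hq : ‖q‖ < 1) (n : ℕ) :
    1 - a * q ^ n ≠ 0 := by
  intro h
  have h1 : ‖a * q ^ n‖ = 1 := by rw [← sub_eq_zero.mp h, norm_one]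
  rw [norm_mul, norm_pow] at h1
  have h2 : ‖q‖ ^ n ≤ 1 := pow_le_one₀ (norm_nonneg _) hq.le
  nlinarith [norm_nonneg a]

theorem qShifted_ne_zero {a q : ℂ} (ha : ‖a‖ < 1) (hq : ‖q‖ < 1) (n : ℕ) :
    qShifted a q n ≠ 0 :=
  prod_ne_zero_iff.mpr fun k _ => one_sub_mul_pow_ne_zero ha hq k

theorem one_sub_pow_succ_ne_zero {q : ℂ} (hq : ‖q‖ < 1) (n : ℕ) : 1 - q ^ (n + 1) ≠ 0 := by
  have := one_sub_mul_pow_ne_zero hq hq n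
  rwa [← pow_succ'] at this

/-- The reciprocal `1 / (q; q)_n`, extended by zero to negative integers `n`. -/
noncomputable def invQFactorial (q : ℂ) (n : ℤ) : ℂ :=
  if 0 ≤ n then (qShifted q q n.toNat)⁻¹ else 0

theorem invQFactorial_natCast (q : ℂ) (n : ℕ) :
    invQFactorial q n = (qShifted q q n)⁻¹ := by
  simp [invQFactorial]

theorem invQFactorial_of_neg (q : ℂ) {n : ℤ} (hn : n < 0) : invQFactorial q n = 0 := by
  simp [invQFactorial, hn]

theorem invQFactorial_zero (q : ℂ) : invQFactorial q 0 = 1 := by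
  simp [invQFactorial, qShifted_zero]

/-- Extension by zero makes this recurrence valid for every integer: at `n = 0` the factor 1 - q^0
vanishes. Sums can then be shifted without treating their endpoints separately. -/
theorem invQFactorial_sub_one {q : ℂ} (hq : ‖q‖ < 1) (n : ℤ) :
    invQFactorial q (n - 1) = (1 - q ^ n) * invQFactorial q n := by
  rcases lt_trichotomy n 0 with h | rfl | h
  · rw [invQFactorial_of_neg q h, invQFactorial_of_neg q (by omega), mul_zero]
  · simp [invQFactorial]
  · obtain ⟨m, rfl⟩ : ∃ m : ℕ, n = (m + 1 : ℕ) := ⟨(n - 1).toNat, by omega⟩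
    rw [show ((m + 1 : ℕ) : ℤ) - 1 = (m : ℕ) by push_cast; ring, invQFactorial_natCast,
      invQFactorial_natCast, qShifted_succ, zpow_natCast, ← pow_succ']
    have h1 := one_sub_pow_succ_ne_zero hq m
    have h2 := qShifted_ne_zero hq hq m
    field_simp

theorem choose_two_succ (n : ℕ) : (n + 1).choose 2 = n.choose 2 + n := by
  rw [Nat.choose_succ_succ' n 1, Nat.choose_one_right, add_comm]

theorem choose_two_add (m n : ℕ) :
    (m + n).choose 2 = m.choose 2 + n.choose 2 + m * n := by
  induction n with
  | zero => simp
  | succ n ih => rw [← add_assoc, choose_two_succ, ih, choose_two_succ]; ring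

/-! ### q-Chu–Vandermonde and the Bailey kernel -/

/-- A form of the `q`-Chu–Vandermonde summation. -/
theorem q_vandermonde {q : ℂ} (hq : ‖q‖ < 1) (x y : ℂ) (M : ℕ) :
    ∑ s ∈ range (M + 1), invQFactorial q s * invQFactorial q ((M : ℤ) - s) *
      (qShifted x q s * (-y) ^ s * q ^ s.choose 2 * qShifted (x * y * q ^ s) q (M - s)) =
    qShifted y q M * invQFactorial q M := by
  induction M generalizing y with
  | zero => simp [qShifted_zero, invQFactorial_zero]
  | succ M ih =>
    -- q-Pascal: 1 - q^(M+1) = (1 - q^s) + q^s (1 - q^(M+1-s)). After shifting s in the first part,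
    -- the two parts recombine through (1 - xq^s)(-y) + (1 - xyq^s) = 1 - y into the sum for `M` at
    -- `y * q`.
    refine mul_left_cancel₀ (one_sub_pow_succ_ne_zero hq M) ?_
    have hM : (1 - q ^ (M + 1)) * invQFactorial q ((M + 1 : ℕ) : ℤ) = invQFactorial q M := by
      have := invQFactorial_sub_one hq ((M + 1 : ℕ) : ℤ)
      rw [zpow_natCast] at this
      rw [← this]
      congr 1
      push_cast
      ring
    rw [mul_left_comm, hM, qShifted_succ', mul_assoc, ← ih (y * q), mul_sum, mul_sum]
    set F : ℕ → ℂ := fun s => qShifted x q s * (-y) ^ s * q ^ s.choose 2 *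
      qShifted (x * y * q ^ s) q (M + 1 - s) with hF
    have key : ∀ s ∈ range (M + 2), (1 - q ^ (M + 1)) *
        (invQFactorial q s * invQFactorial q (((M + 1 : ℕ) : ℤ) - s) * F s) =
        invQFactorial q ((s : ℤ) - 1) * invQFactorial q (((M + 1 : ℕ) : ℤ) - s) * F s +
        q ^ s * invQFactorial q s * invQFactorial q ((M : ℤ) - s) * F s := by
      intro s hs
      have hs' : s ≤ M + 1 := by simpa [Nat.lt_succ_iff] using hs
      have h1 := invQFactorial_sub_one hq (s : ℤ)
      have h2 := invQFactorial_sub_one hq (((M + 1 : ℕ) : ℤ) - s)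
      rw [zpow_natCast] at h1
      rw [← Nat.cast_sub hs', zpow_natCast, Nat.cast_sub hs',
        show ((M + 1 : ℕ) : ℤ) - s - 1 = (M : ℤ) - s by push_cast; ring] at h2
      rw [h1, h2]
      have h3 : q ^ (M + 1) = q ^ s * q ^ (M + 1 - s) := by rw [← pow_add]; congr 1; omega
      rw [h3]
      ring
    rw [sum_congr rfl key, sum_add_distrib, sum_range_succ' _ (M + 1), sum_range_succ _ (M + 1)]
    rw [invQFactorial_of_neg q (show ((0 : ℕ) : ℤ) - 1 < 0 by norm_num),
      invQFactorial_of_neg q (show (M : ℤ) - (M + 1 : ℕ) < 0 by push_cast; omega)]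
    simp only [zero_mul, mul_zero, add_zero]
    rw [← sum_add_distrib]
    refine sum_congr rfl fun s hs => ?_
    have hs' : s ≤ M := by simpa [Nat.lt_succ_iff] using hs
    rw [show ((s + 1 : ℕ) : ℤ) - 1 = s by push_cast; ring,
      show ((M + 1 : ℕ) : ℤ) - (s + 1 : ℕ) = (M : ℤ) - s by push_cast; ring]
    simp only [hF]
    rw [show M + 1 - s = (M - s) + 1 by omega, show M + 1 - (s + 1) = M - s by omega,
      qShifted_succ' (x * y * q ^ s), qShifted_succ, choose_two_succ,
      show x * y * q ^ (s + 1) = x * y * q ^ s * q by ring,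
      show x * (y * q) * q ^ s = x * y * q ^ s * q by ring,
      show (-(y * q)) ^ s = (-y) ^ s * q ^ s by rw [← mul_pow]; ring]
    ring

theorem q_binomial {q : ℂ} (hq : ‖q‖ < 1) (y : ℂ) (M : ℕ) :
    ∑ s ∈ range (M + 1), invQFactorial q s * invQFactorial q ((M : ℤ) - s) *
      ((-y) ^ s * q ^ s.choose 2) = qShifted y q M * invQFactorial q M := by
  rw [← q_vandermonde hq 0 y M]
  simp [qShifted]

/-- The kernel of the Bailey transform with parameters `-q` and `∞`, relative to `q`. -/
theorem bailey_kernel {q : ℂ} (hq : ‖q‖ < 1) (n M : ℕ) :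
    ∑ r ∈ range (n + M + 1), qShifted (-q) q r * q ^ (r + 1).choose 2 *
      invQFactorial q (((n + M : ℕ) : ℤ) - r) *
      (invQFactorial q ((r : ℤ) - n) * invQFactorial q ((r : ℤ) + n + 1)) =
    qShifted (-q) q (n + M) * q ^ (n + 1).choose 2 *
      (invQFactorial q (((n + M : ℕ) : ℤ) - n) *
        invQFactorial q (((n + M : ℕ) : ℤ) + n + 1)) := by
  rw [add_assoc n M 1, sum_range_add, sum_eq_zero, zero_add]
  swap
  · intro r hr
    have : r < n := by simpa using hr
    rw [invQFactorial_of_neg q (show (r : ℤ) - n < 0 by omega)]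
    simp
  -- With r = n + s and x = y = -q^(n+1), the product xyq^s = q^(2n+s+2) supplies the ratio of
  -- (q;q)_{n+M+n+1} to (q;q)_{2n+s+1}.
  have hV := q_vandermonde hq (-q ^ (n + 1)) (-q ^ (n + 1)) M
  have hn : (-q) * q ^ n = -q ^ (n + 1) := by ring
  rw [qShifted_add, hn, show (((n + M : ℕ) : ℤ) - n) = (M : ℤ) by push_cast; ring]
  have e1 : qShifted (-q) q n * qShifted (-q ^ (n + 1)) q M * q ^ (n + 1).choose 2 *
      (invQFactorial q M * invQFactorial q (((n + M : ℕ) : ℤ) + n + 1)) =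
      qShifted (-q) q n * q ^ (n + 1).choose 2 *
        invQFactorial q (((n + M : ℕ) : ℤ) + n + 1) *
      (qShifted (-q ^ (n + 1)) q M * invQFactorial q M) := by ring
  rw [e1, ← hV, mul_sum]
  refine sum_congr rfl fun s hs => ?_
  have hs' : s ≤ M := by simpa [Nat.lt_succ_iff] using hs
  have h3 : invQFactorial q (((n + s : ℕ) : ℤ) + n + 1) =
      qShifted (-q ^ (n + 1) * -q ^ (n + 1) * q ^ s) q (M - s) *
        invQFactorial q (((n + M : ℕ) : ℤ) + n + 1) := by
    rw [show ((n + s : ℕ) : ℤ) + n + 1 = (2 * n + s + 1 : ℕ) by push_cast; ring,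
      show ((n + M : ℕ) : ℤ) + n + 1 = ((2 * n + s + 1 + (M - s) : ℕ) : ℤ) by
        push_cast [hs']; ring, invQFactorial_natCast, invQFactorial_natCast, qShifted_add q q (2 * n + s + 1),
      show -q ^ (n + 1) * -q ^ (n + 1) * q ^ s = q * q ^ (2 * n + s + 1) by ring]
    have hb : ‖q * q ^ (2 * n + s + 1)‖ < 1 := by
      rw [← pow_succ', norm_pow]
      exact pow_lt_one₀ (norm_nonneg _) hq (by omega)
    have h4 := qShifted_ne_zero hb hq (M - s)
    have h5 := qShifted_ne_zero hq hq (2 * n + s + 1)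
    field_simp
  rw [h3, qShifted_add, hn, show ((n + s : ℕ) : ℤ) - n = s by push_cast; ring,
    show ((n + M : ℕ) : ℤ) - (n + s : ℕ) = (M : ℤ) - s by push_cast; ring,
    show n + s + 1 = (n + 1) + s by ring, choose_two_add (n + 1) s, neg_neg, ← pow_mul, pow_add,
    pow_add]
  ring

/-! ### The Bailey pair and the terminating identity -/

/-- The finite theta sum `∑_{|j| ≤ n} (-1)^j q^{-j²}`. -/
noncomputable def finiteTheta (q : ℂ) (n : ℕ) : ℂ :=
  ∑ j ∈ Icc (-(n : ℤ)) (n : ℤ), (-1 : ℂ) ^ j * q ^ (-j ^ 2)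

theorem finiteTheta_zero (q : ℂ) : finiteTheta q 0 = 1 := by simp [finiteTheta]

theorem finiteTheta_succ (q : ℂ) (n : ℕ) :
    finiteTheta q (n + 1) = finiteTheta q n + 2 * (-1) ^ (n + 1) * (q ^ (n + 1) ^ 2)⁻¹ := by
  have h : Icc (-((n + 1 : ℕ) : ℤ)) ((n + 1 : ℕ) : ℤ) =
      insert (-((n + 1 : ℕ) : ℤ)) (insert (((n + 1 : ℕ) : ℤ)) (Icc (-(n : ℤ)) (n : ℤ))) := by
    ext j
    simp only [mem_Icc, mem_insert]
    omega
  have h1 : (-1 : ℂ) ^ (-((n + 1 : ℕ) : ℤ)) = (-1) ^ (n + 1) := by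
    rw [zpow_neg, zpow_natCast, ← inv_pow]; norm_num
  have h2 : q ^ (-((n + 1 : ℕ) : ℤ) ^ 2) = (q ^ (n + 1) ^ 2)⁻¹ := by
    rw [zpow_neg, ← zpow_natCast]; push_cast; rfl
  rw [finiteTheta, h, sum_insert, sum_insert, ← finiteTheta, h1, neg_sq, h2, zpow_natCast]
  · ring
  · simp
  · simp only [mem_insert, mem_Icc]; omega

/-- Truncation of `∑_j (-1)^j / ((q; q)_{r-j} (q; q)_{r+j})` at `|j| ≤ N`. -/
noncomputable def gaussPartial (q : ℂ) (r : ℤ) (N : ℕ) : ℂ :=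
  invQFactorial q r ^ 2 +
    2 * ∑ j ∈ range N, (-1) ^ (j + 1) * (invQFactorial q (r - (j + 1)) *
      invQFactorial q (r + (j + 1)))

/-- Summation by parts. The factor multiplying `finiteTheta q n` is a difference of consecutive
values of q^(n²) / ((q;q)_{r-n} (q;q)_{r+n}), and the increments of `finiteTheta` carry q^(-n²),
which cancels the power of q. -/
theorem sum_mul_finiteTheta {q : ℂ} (hq0 : q ≠ 0) (hq : ‖q‖ < 1) (r N : ℕ) :
    ∑ n ∈ range (N + 1), (1 - q ^ (2 * n + 1)) * q ^ n ^ 2 * finiteTheta q n *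
      (invQFactorial q ((r : ℤ) - n) * invQFactorial q ((r : ℤ) + n + 1)) =
    gaussPartial q r N - q ^ (N + 1) ^ 2 * finiteTheta q N *
      (invQFactorial q ((r : ℤ) - (N + 1)) * invQFactorial q ((r : ℤ) + (N + 1))) := by
  have tel : ∀ n : ℕ, (1 - q ^ (2 * n + 1)) * q ^ n ^ 2 *
      (invQFactorial q ((r : ℤ) - n) * invQFactorial q ((r : ℤ) + n + 1)) =
      q ^ n ^ 2 * (invQFactorial q ((r : ℤ) - n) * invQFactorial q ((r : ℤ) + n)) -
      q ^ (n + 1) ^ 2 * (invQFactorial q ((r : ℤ) - (n + 1)) *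
        invQFactorial q ((r : ℤ) + (n + 1))) := by
    intro n
    have h1 := invQFactorial_sub_one hq ((r : ℤ) + n + 1)
    have h2 := invQFactorial_sub_one hq ((r : ℤ) - n)
    rw [add_sub_cancel_right] at h1
    rw [sub_sub] at h2
    rw [h1, h2, ← add_assoc,
      show (r : ℤ) + n + 1 = ((r : ℤ) - n) + ((2 * n + 1 : ℕ) : ℤ) by push_cast; ring,
      zpow_add₀ hq0, zpow_natCast, show (n + 1) ^ 2 = n ^ 2 + (2 * n + 1) by ring, pow_add q]
    ring
  induction N with
  | zero =>
    have := tel 0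
    simp only [zero_add, range_one, sum_singleton, finiteTheta_zero, gaussPartial, range_zero,
      sum_empty, mul_zero, add_zero, mul_one]
    rw [this]
    simp [sq]
  | succ N ih =>
    have h := tel (N + 1)
    rw [sum_range_succ, ih]
    have e : ∀ A B C D : ℂ, A * B * C * D = C * (A * B * D) := fun _ _ _ _ => by ring
    rw [e, h, finiteTheta_succ, gaussPartial, gaussPartial, sum_range_succ]
    have h0 : q ^ (N + 1) ^ 2 ≠ 0 := pow_ne_zero _ hq0
    push_cast
    field_simp
    ring

/-- With x = q^(r-j) and y = q^(r+j), (1 - xy) + (1 - x)(1 - y) = (1 - x) + (1 - y), so the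
alternating sum over j telescopes to one boundary term. -/
theorem gaussPartial_rec {q : ℂ} (hq0 : q ≠ 0) (hq : ‖q‖ < 1) (r : ℤ) (N : ℕ) :
    (1 - q ^ (2 * r)) * gaussPartial q r N + gaussPartial q (r - 1) N =
      2 * (-1) ^ N * (invQFactorial q (r - (N + 1)) * invQFactorial q (r + N)) := by
  induction N with
  | zero =>
    simp only [gaussPartial, range_zero, sum_empty, mul_zero, add_zero, pow_zero, mul_one,
      Nat.cast_zero, zero_add]
    rw [invQFactorial_sub_one hq r, two_mul r, zpow_add₀ hq0]
    ring
  | succ N ih =>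
    rw [gaussPartial, gaussPartial, sum_range_succ, sum_range_succ]
    rw [gaussPartial, gaussPartial] at ih
    have e1 := invQFactorial_sub_one hq (r - (N + 1))
    have e2 := invQFactorial_sub_one hq (r + (N + 1))
    rw [show r - 1 - ((N : ℤ) + 1) = r - (N + 1) - 1 by ring,
      show r - 1 + ((N : ℤ) + 1) = r + (N + 1) - 1 by ring, e1, e2]
    push_cast
    rw [show r - ((N : ℤ) + 1 + 1) = r - (N + 1) - 1 by ring, e1]
    rw [show r + (N : ℤ) = r + (N + 1) - 1 by ring, e2] at ih
    have e3 : q ^ (2 * r) = q ^ (r - ((N : ℤ) + 1)) * q ^ (r + ((N : ℤ) + 1)) := by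
      rw [← zpow_add₀ hq0]; congr 1; ring
    rw [e3] at ih ⊢
    linear_combination ih

/-- For `r ≤ N` the boundary term of `gaussPartial_rec` is zero, leaving a first-order recurrence in
r. -/
theorem gaussPartial_eq {q : ℂ} (hq0 : q ≠ 0) (hq : ‖q‖ < 1) (r N : ℕ) (h : r ≤ N) :
    gaussPartial q r N * qShifted (-q) q r = (-1) ^ r * invQFactorial q r := by
  induction r with
  | zero =>
    rw [gaussPartial, sum_eq_zero]
    · simp [qShifted_zero, invQFactorial_zero]
    · intro j _
      rw [invQFactorial_of_neg q (show ((0 : ℕ) : ℤ) - (j + 1) < 0 by push_cast; omega)]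
      simp
  | succ r ih =>
    have h1 := gaussPartial_rec hq0 hq ((r + 1 : ℕ) : ℤ) N
    rw [invQFactorial_of_neg q (show ((r + 1 : ℕ) : ℤ) - (N + 1) < 0 by push_cast; omega),
      show ((r + 1 : ℕ) : ℤ) - 1 = (r : ℕ) by push_cast; ring] at h1
    have h2 := invQFactorial_sub_one hq ((r + 1 : ℕ) : ℤ)
    rw [show ((r + 1 : ℕ) : ℤ) - 1 = (r : ℕ) by push_cast; ring, zpow_natCast] at h2
    have h3 := ih (by omega)
    rw [h2] at h3
    rw [two_mul, zpow_add₀ hq0, zpow_natCast] at h1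
    rw [qShifted_succ]
    refine mul_left_cancel₀ (one_sub_pow_succ_ne_zero hq r) ?_
    linear_combination qShifted (-q) q r * h1 - h3

/-- The finite form of the main expansion. -/
theorem sum_finiteTheta_eq {q : ℂ} (hq0 : q ≠ 0) (hq : ‖q‖ < 1) (L : ℕ) :
    qShifted (-q) q L * ∑ n ∈ range (L + 1), (1 - q ^ (2 * n + 1)) * q ^ n ^ 2 *
      finiteTheta q n * q ^ (n + 1).choose 2 *
      (invQFactorial q ((L : ℤ) - n) * invQFactorial q ((L : ℤ) + n + 1)) = 1 := by
  have h1 : ∀ n ∈ range (L + 1), qShifted (-q) q L * ((1 - q ^ (2 * n + 1)) * q ^ n ^ 2 *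
      finiteTheta q n * q ^ (n + 1).choose 2 *
      (invQFactorial q ((L : ℤ) - n) * invQFactorial q ((L : ℤ) + n + 1))) =
      ∑ r ∈ range (L + 1), qShifted (-q) q r * q ^ (r + 1).choose 2 *
        invQFactorial q ((L : ℤ) - r) * ((1 - q ^ (2 * n + 1)) * q ^ n ^ 2 * finiteTheta q n *
        (invQFactorial q ((r : ℤ) - n) * invQFactorial q ((r : ℤ) + n + 1))) := by
    intro n hn
    obtain ⟨M, rfl⟩ : ∃ M, L = n + M := Nat.exists_eq_add_of_le (by simpa [Nat.lt_succ_iff] using hn)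
    have hk := bailey_kernel hq n M
    calc _ = (1 - q ^ (2 * n + 1)) * q ^ n ^ 2 * finiteTheta q n * (qShifted (-q) q (n + M) *
          q ^ (n + 1).choose 2 * (invQFactorial q (((n + M : ℕ) : ℤ) - n) *
          invQFactorial q (((n + M : ℕ) : ℤ) + n + 1))) := by ring
      _ = _ := by
        rw [← hk, mul_sum]
        exact sum_congr rfl fun r _ => by ring
  -- At y = q the q-binomial sum is (q;q)_L / (q;q)_L = 1.
  have hb := q_binomial hq q L
  rw [invQFactorial_natCast, mul_inv_cancel₀ (qShifted_ne_zero hq hq L)] at hb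
  rw [mul_sum, sum_congr rfl h1, sum_comm]
  refine Eq.trans (sum_congr rfl fun r hr => ?_) hb
  have hr' : r ≤ L := by simpa [Nat.lt_succ_iff] using hr
  rw [← mul_sum, sum_mul_finiteTheta hq0 hq,
    invQFactorial_of_neg q (show (r : ℤ) - (L + 1) < 0 by omega), zero_mul, mul_zero, sub_zero]
  have hg := gaussPartial_eq hq0 hq r L hr'
  calc _ = q ^ (r + 1).choose 2 * invQFactorial q ((L : ℤ) - r) *
        (gaussPartial q r L * qShifted (-q) q r) := by ring
    _ = _ := by
      rw [hg, choose_two_succ, pow_add, neg_pow q]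
      ring

/-! ### Infinite products -/

theorem summable_norm_mul_pow (a : ℂ) {q : ℂ} (hq : ‖q‖ < 1) :
    Summable fun k : ℕ => ‖-(a * q ^ k)‖ := by
  simpa [norm_mul, norm_pow] using
    (summable_geometric_of_lt_one (norm_nonneg q) hq).mul_left ‖a‖

theorem qShiftedInf_ne_zero {a q : ℂ} (ha : ‖a‖ < 1) (hq : ‖q‖ < 1) : qShiftedInf a q ≠ 0 := by
  have := tprod_one_add_ne_zero_of_summable (f := fun k : ℕ => -(a * q ^ k))
    (fun k => by simpa [sub_eq_add_neg] using one_sub_mul_pow_ne_zero ha hq k)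
    (summable_norm_mul_pow a hq)
  simpa [qShiftedInf, sub_eq_add_neg] using this

theorem qShiftedInf_eq_mul (a : ℂ) {q : ℂ} (hq : ‖q‖ < 1) (n : ℕ) :
    qShiftedInf a q = qShifted a q n * qShiftedInf (a * q ^ n) q := by
  have h : (fun k : ℕ => 1 - a * q ^ n * q ^ k) = fun k => 1 - a * q ^ (k + n) := by
    funext k
    rw [pow_add]
    ring
  have hm := multipliable_qShiftedInf (a * q ^ n) q hq
  rw [h] at hm
  rw [qShiftedInf, qShiftedInf, qShifted, h]
  exact (Multipliable.prod_mul_tprod_nat_mul' (f := fun k => 1 - a * q ^ k) hm).symm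

theorem tendsto_qShifted (a : ℂ) {q : ℂ} (hq : ‖q‖ < 1) :
    Tendsto (fun n => qShifted a q n) atTop (𝓝 (qShiftedInf a q)) :=
  (multipliable_qShiftedInf a q hq).tendsto_prod_tprod_nat

theorem norm_sq_lt_one {q : ℂ} (hq : ‖q‖ < 1) : ‖q ^ 2‖ < 1 := by
  rw [norm_pow]
  exact pow_lt_one₀ (norm_nonneg _) hq (by norm_num)

theorem qShiftedInf_even_odd (a : ℂ) {q : ℂ} (hq : ‖q‖ < 1) :
    qShiftedInf a (q ^ 2) * qShiftedInf (a * q) (q ^ 2) = qShiftedInf a q := by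
  have h1 : (fun k : ℕ => 1 - a * (q ^ 2) ^ k) = fun k => 1 - a * q ^ (2 * k) := by
    funext k; rw [pow_mul]
  have h2 : (fun k : ℕ => 1 - a * q * (q ^ 2) ^ k) = fun k => 1 - a * q ^ (2 * k + 1) := by
    funext k; rw [pow_succ q (2 * k), pow_mul]; ring
  have m1 := multipliable_qShiftedInf a _ (norm_sq_lt_one hq)
  have m2 := multipliable_qShiftedInf (a * q) _ (norm_sq_lt_one hq)
  rw [h1] at m1
  rw [h2] at m2
  rw [qShiftedInf, qShiftedInf, qShiftedInf, h1, h2]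
  exact tprod_even_mul_odd (f := fun k => 1 - a * q ^ k) m1 m2

theorem qShiftedInf_mul_neg (a : ℂ) {q : ℂ} (hq : ‖q‖ < 1) :
    qShiftedInf a q * qShiftedInf (-a) q = qShiftedInf (a ^ 2) (q ^ 2) := by
  rw [qShiftedInf, qShiftedInf, qShiftedInf, ← (multipliable_qShiftedInf a q hq).tprod_mul
    (multipliable_qShiftedInf (-a) q hq)]
  congr 1
  funext k
  rw [← pow_mul, mul_comm 2 k, pow_mul]
  ring

/-- Euler's identity `(-q; q)_∞ (q; q²)_∞ = 1`. -/
theorem euler_identity {q : ℂ} (hq : ‖q‖ < 1) :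
    qShiftedInf (-q) q * qShiftedInf q (q ^ 2) = 1 := by
  have h1 := qShiftedInf_even_odd q hq
  have h2 := qShiftedInf_mul_neg q hq
  have h0 := qShiftedInf_ne_zero (norm_sq_lt_one hq) (norm_sq_lt_one hq)
  rw [← h1, ← sq] at h2
  refine mul_left_cancel₀ h0 ?_
  linear_combination h2

theorem differentiableOn_qShiftedInf {q : ℂ} (hq : ‖q‖ < 1) :
    DifferentiableOn ℂ (fun a => qShiftedInf a q) (Metric.ball 0 1) := by
  have h := Summable.hasProdLocallyUniformlyOn_one_add (f := fun (k : ℕ) (a : ℂ) => -(a * q ^ k))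
    (K := Metric.ball (0 : ℂ) 1) Metric.isOpen_ball
    (summable_geometric_of_lt_one (norm_nonneg q) hq)
    (Eventually.of_forall fun k a ha => by
      rw [norm_neg, norm_mul, norm_pow]
      exact mul_le_of_le_one_left (by positivity) (mem_ball_zero_iff.mp ha).le)
    (fun k => by fun_prop)
  rw [hasProdLocallyUniformlyOn_iff_tendstoLocallyUniformlyOn] at h
  have h2 := h.differentiableOn (Eventually.of_forall fun s => by fun_prop) Metric.isOpen_ball
  simpa [qShiftedInf, sub_eq_add_neg] using h2

/-! ### Convergence and analyticity of the series in a -/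

theorem sum_range_pow_le {t : ℝ} (h0 : 0 ≤ t) (h1 : t < 1) (n : ℕ) :
    ∑ k ∈ range n, t ^ k ≤ (1 - t)⁻¹ := by
  rw [← tsum_geometric_of_lt_one h0 h1]
  exact (summable_geometric_of_lt_one h0 h1).sum_le_tsum _ fun _ _ => by positivity

/-- Each factor is at most ρ(1 + |q|^k/ρ) ≤ ρ exp(|q|^k/ρ), and the exponents form a geometric
series. The factor ρ^n drives the convergence of the whole expansion. -/
theorem norm_qNumer_le {a q : ℂ} {ρ : ℝ} (hρ : 0 < ρ) (ha : ‖a‖ ≤ ρ) (hq : ‖q‖ < 1) (n : ℕ) :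
    ‖qNumer a q n‖ ≤ Real.exp (ρ⁻¹ * (1 - ‖q‖)⁻¹) * ρ ^ n := by
  have h : ∀ k ∈ range n, ‖a - q ^ (k + 1)‖ ≤ Real.exp (ρ⁻¹ * ‖q‖ ^ k) * ρ := by
    intro k _
    have h1 : ‖a - q ^ (k + 1)‖ ≤ ρ + ‖q‖ ^ k := by
      refine (norm_sub_le _ _).trans (add_le_add ha ?_)
      rw [norm_pow]
      exact pow_le_pow_of_le_one (norm_nonneg _) hq.le (by omega)
    have h2 := Real.add_one_le_exp (ρ⁻¹ * ‖q‖ ^ k)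
    calc _ ≤ ρ + ‖q‖ ^ k := h1
      _ = (ρ⁻¹ * ‖q‖ ^ k + 1) * ρ := by field_simp; ring
      _ ≤ _ := by gcongr
  rw [qNumer, norm_prod]
  refine (prod_le_prod (fun _ _ => norm_nonneg _) h).trans ?_
  rw [prod_mul_distrib, prod_const, card_range, ← Real.exp_sum, ← mul_sum]
  gcongr
  exact sum_range_pow_le (norm_nonneg _) hq n

theorem norm_inv_qShifted_le {a q : ℂ} {ρ : ℝ} (hρ : ρ < 1) (ha : ‖a‖ ≤ ρ) (hq : ‖q‖ < 1) (n : ℕ) :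
    ‖(qShifted a q n)⁻¹‖ ≤ Real.exp ((1 - ρ)⁻¹ * (1 - ‖q‖)⁻¹) := by
  have hρ' : 0 < 1 - ρ := by linarith
  have h : ∀ k ∈ range n, ‖(1 - a * q ^ k)⁻¹‖ ≤ Real.exp ((1 - ρ)⁻¹ * ‖q‖ ^ k) := by
    intro k _
    have hk0 : 0 ≤ ‖q‖ ^ k := by positivity
    have hk1 : ‖q‖ ^ k ≤ 1 := pow_le_one₀ (norm_nonneg _) hq.le
    have h0 : ‖a * q ^ k‖ ≤ ρ * ‖q‖ ^ k := by
      rw [norm_mul, norm_pow]; gcongr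
    have hρ0 : 0 ≤ ρ := (norm_nonneg a).trans ha
    have h1 : 1 - ρ * ‖q‖ ^ k ≤ ‖1 - a * q ^ k‖ := by
      have := norm_sub_norm_le (1 : ℂ) (a * q ^ k)
      rw [norm_one] at this
      linarith
    have h2 : 1 - ρ ≤ 1 - ρ * ‖q‖ ^ k := by nlinarith
    have h3 := Real.add_one_le_exp ((1 - ρ)⁻¹ * ‖q‖ ^ k)
    rw [norm_inv]
    refine le_trans ?_ h3
    rw [inv_le_iff_one_le_mul₀ (by linarith)]
    have h4 : 0 ≤ (1 - ρ)⁻¹ * ‖q‖ ^ k := by positivity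
    calc (1 : ℝ) ≤ ((1 - ρ)⁻¹ * ‖q‖ ^ k + 1) * (1 - ρ * ‖q‖ ^ k) := by
          have h5 : (1 - ρ)⁻¹ * ‖q‖ ^ k * (1 - ρ) ≤
              (1 - ρ)⁻¹ * ‖q‖ ^ k * (1 - ρ * ‖q‖ ^ k) := by gcongr
          have h6 : (1 - ρ)⁻¹ * ‖q‖ ^ k * (1 - ρ) = ‖q‖ ^ k := by field_simp
          nlinarith
      _ ≤ _ := by gcongr
  rw [qShifted, ← prod_inv_distrib, norm_prod]
  refine (prod_le_prod (fun _ _ => norm_nonneg _) h).trans ?_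
  rw [← Real.exp_sum, ← mul_sum]
  gcongr
  exact sum_range_pow_le (norm_nonneg _) hq n

/-- The coefficients `∑_{|j| ≤ n} (-1)^{n+j} (1 - q^{2n+1}) q^{n²-j²}`. -/
noncomputable def heckeCoeff (q : ℂ) (n : ℕ) : ℂ :=
  ∑ j ∈ Icc (-(n : ℤ)) (n : ℤ),
    (-1 : ℂ) ^ ((n : ℤ) + j) * (1 - q ^ (2 * n + 1)) * q ^ ((n : ℤ) ^ 2 - j ^ 2)

theorem heckeCoeff_eq {q : ℂ} (hq0 : q ≠ 0) (n : ℕ) :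
    heckeCoeff q n = (-1) ^ n * ((1 - q ^ (2 * n + 1)) * q ^ n ^ 2 * finiteTheta q n) := by
  rw [heckeCoeff, finiteTheta, mul_sum, mul_sum]
  refine sum_congr rfl fun j _ => ?_
  rw [zpow_add₀ (by norm_num), sub_eq_add_neg ((n : ℤ) ^ 2), zpow_add₀ hq0, zpow_natCast,
    show ((n : ℤ) ^ 2) = ((n ^ 2 : ℕ) : ℤ) by push_cast; rfl, zpow_natCast]
  ring

/-- The exponents n² - j² are nonnegative for |j| ≤ n. Linear growth suffices, since `qNumer` decays
geometrically. -/
theorem norm_heckeCoeff_le {q : ℂ} (hq : ‖q‖ < 1) (n : ℕ) :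
    ‖heckeCoeff q n‖ ≤ 2 * (2 * n + 1) := by
  rw [heckeCoeff]
  refine (norm_sum_le_of_le _ (n := fun _ => (2 : ℝ)) fun j hj => ?_).trans ?_
  · rw [mem_Icc] at hj
    obtain ⟨m, hm⟩ : ∃ m : ℕ, (n : ℤ) ^ 2 - j ^ 2 = m :=
      Int.eq_ofNat_of_zero_le (by nlinarith)
    rw [hm, zpow_natCast, norm_mul, norm_mul, norm_zpow, norm_neg, norm_one, one_zpow, one_mul,
      norm_pow]
    have h1 : ‖(1 : ℂ) - q ^ (2 * n + 1)‖ ≤ 2 := by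
      refine (norm_sub_le _ _).trans ?_
      rw [norm_one, norm_pow]
      linarith [pow_le_one₀ (norm_nonneg q) hq.le (n := 2 * n + 1)]
    have h2 : ‖q‖ ^ m ≤ 1 := pow_le_one₀ (norm_nonneg _) hq.le
    calc _ ≤ (2 : ℝ) * 1 := by gcongr
      _ = 2 := by norm_num
  · rw [sum_const, Int.card_Icc, nsmul_eq_mul]
    have : ((n : ℤ) + 1 - -n).toNat = 2 * n + 1 := by omega
    rw [this]
    push_cast
    linarith

/-- The terms of the expansion of the theta quotient in the functions
`(q/a; q)_n a^n / (a; q)_{n+1}`. -/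
noncomputable def heckeTerm (q : ℂ) (n : ℕ) (a : ℂ) : ℂ :=
  heckeCoeff q n * (qNumer a q n / qShifted a q (n + 1))

theorem exists_heckeTerm_bound {q : ℂ} (hq : ‖q‖ < 1) {ρ : ℝ} (hρ0 : 0 < ρ) (hρ : ρ < 1) :
    ∃ u : ℕ → ℝ, Summable u ∧ ∀ n a, ‖a‖ ≤ ρ → ‖heckeTerm q n a‖ ≤ u n := by
  set C := Real.exp (ρ⁻¹ * (1 - ‖q‖)⁻¹)
  set D := Real.exp ((1 - ρ)⁻¹ * (1 - ‖q‖)⁻¹)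
  refine ⟨fun n => 2 * (2 * n + 1) * (C * ρ ^ n * D), ?_, fun n a ha => ?_⟩
  · have h1 := summable_pow_mul_geometric_of_norm_lt_one 1
      (show ‖ρ‖ < 1 by rwa [Real.norm_of_nonneg hρ0.le])
    have h2 := summable_geometric_of_lt_one hρ0.le hρ
    refine ((h1.mul_left (4 * C * D)).add (h2.mul_left (2 * C * D))).congr fun n => ?_
    ring
  · rw [heckeTerm, div_eq_mul_inv, norm_mul, norm_mul]
    have h1 := norm_heckeCoeff_le hq n
    have h2 := norm_qNumer_le hρ0 ha hq n
    have h3 := norm_inv_qShifted_le hρ ha hq (n + 1)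
    exact mul_le_mul h1 (mul_le_mul h2 h3 (norm_nonneg _) (by positivity)) (by positivity)
      (by positivity)

theorem differentiableOn_heckeTerm {q : ℂ} (hq : ‖q‖ < 1) (n : ℕ) :
    DifferentiableOn ℂ (heckeTerm q n) (Metric.ball 0 1) := by
  unfold heckeTerm
  refine DifferentiableOn.const_mul (DifferentiableOn.div ?_ ?_ ?_) _
  · unfold qNumer; fun_prop
  · unfold qShifted; fun_prop
  · exact fun a ha => qShifted_ne_zero (mem_ball_zero_iff.mp ha) hq _

theorem exists_between_norm {a : ℂ} (ha : ‖a‖ < 1) : ∃ ρ : ℝ, ‖a‖ < ρ ∧ 0 < ρ ∧ ρ < 1 := by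
  obtain ⟨ρ, h1, h2⟩ := exists_between ha
  exact ⟨ρ, h1, (norm_nonneg a).trans_lt h1, h2⟩

theorem summable_heckeTerm {a q : ℂ} (ha : ‖a‖ < 1) (hq : ‖q‖ < 1) :
    Summable fun n => heckeTerm q n a := by
  obtain ⟨ρ, h1, h0, h2⟩ := exists_between_norm ha
  obtain ⟨u, hu, hb⟩ := exists_heckeTerm_bound hq h0 h2
  exact Summable.of_norm_bounded hu fun n => hb n a h1.le

theorem differentiableOn_tsum_heckeTerm {q : ℂ} (hq : ‖q‖ < 1) :
    DifferentiableOn ℂ (fun a => ∑' n, heckeTerm q n a) (Metric.ball 0 1) := by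
  intro a ha
  -- The bound is uniform only on discs of radius ρ < 1, so differentiability is proved locally.
  obtain ⟨ρ, h1, h0, h2⟩ := exists_between_norm (mem_ball_zero_iff.mp ha)
  obtain ⟨u, hu, hb⟩ := exists_heckeTerm_bound hq h0 h2
  have hd := Complex.differentiableOn_tsum_of_summable_norm hu (F := heckeTerm q)
    (U := Metric.ball 0 ρ)
    (fun n => (differentiableOn_heckeTerm hq n).mono (Metric.ball_subset_ball h2.le))
    Metric.isOpen_ball (fun n w hw => hb n w (mem_ball_zero_iff.mp hw).le)
  exact (hd.differentiableAt (Metric.isOpen_ball.mem_nhds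
    (mem_ball_zero_iff.mpr h1))).differentiableWithinAt

/-! ### Termination at a = q^(m+1) and the identity theorem -/

/-- From q^(m+1) - q^(k+1) = -q^(k+1) (1 - q^(m-k)). For n > m both sides are zero, which is what
truncates the series. -/
theorem qNumer_pow_succ {q : ℂ} (hq0 : q ≠ 0) (hq : ‖q‖ < 1) (m n : ℕ) :
    qNumer (q ^ (m + 1)) q n * invQFactorial q m =
      (-1) ^ n * q ^ (n + 1).choose 2 * invQFactorial q ((m : ℤ) - n) := by
  induction n with
  | zero => simp [qNumer]
  | succ n ih =>
    have h1 := invQFactorial_sub_one hq ((m : ℤ) - n)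
    rw [qNumer, prod_range_succ, ← qNumer, mul_right_comm, ih]
    rw [show (m : ℤ) - (n + 1 : ℕ) = (m : ℤ) - n - 1 by push_cast; ring, h1,
      choose_two_succ (n + 1), zpow_sub₀ hq0, zpow_natCast, zpow_natCast]
    have : q ^ n ≠ 0 := pow_ne_zero _ hq0
    field_simp
    ring

theorem heckeTerm_pow_succ {q : ℂ} (hq0 : q ≠ 0) (hq : ‖q‖ < 1) (m n : ℕ) :
    heckeTerm q n (q ^ (m + 1)) = qShifted q q m ^ 2 * ((1 - q ^ (2 * n + 1)) * q ^ n ^ 2 *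
      finiteTheta q n * q ^ (n + 1).choose 2 *
      (invQFactorial q ((m : ℤ) - n) * invQFactorial q ((m : ℤ) + n + 1))) := by
  have h0 := qShifted_ne_zero hq hq m
  have h1 := qNumer_pow_succ hq0 hq m n
  have h2 := qShifted_add q q m (n + 1)
  rw [← pow_succ'] at h2
  have h3 : qNumer (q ^ (m + 1)) q n =
      (-1) ^ n * q ^ (n + 1).choose 2 * invQFactorial q ((m : ℤ) - n) * qShifted q q m := by
    rw [← h1, invQFactorial_natCast, inv_mul_cancel_right₀ h0]
  have h4 : (qShifted (q ^ (m + 1)) q (n + 1))⁻¹ =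
      invQFactorial q ((m : ℤ) + n + 1) * qShifted q q m := by
    rw [show (m : ℤ) + n + 1 = ((m + (n + 1) : ℕ) : ℤ) by push_cast; ring, invQFactorial_natCast,
      h2, mul_inv, mul_comm, mul_inv_cancel_left₀ h0]
  have h5 : ((-1 : ℂ) ^ n) * (-1) ^ n = 1 := by rw [← mul_pow]; norm_num
  rw [heckeTerm, heckeCoeff_eq hq0, div_eq_mul_inv, h3, h4]
  linear_combination (1 - q ^ (2 * n + 1)) * q ^ n ^ 2 * finiteTheta q n *
    q ^ (n + 1).choose 2 * invQFactorial q ((m : ℤ) - n) * invQFactorial q ((m : ℤ) + n + 1) *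
    qShifted q q m ^ 2 * h5

/-- The theta quotient expanded in `hasSum_heckeTerm`. -/
noncomputable def thetaQuotient (q a : ℂ) : ℂ :=
  qShiftedInf q q ^ 2 * qShiftedInf (-a) q / (qShiftedInf a q ^ 2 * qShiftedInf (-q) q)

theorem tsum_heckeTerm_pow_succ {q : ℂ} (hq0 : q ≠ 0) (hq : ‖q‖ < 1) (m : ℕ) :
    ∑' n, heckeTerm q n (q ^ (m + 1)) = thetaQuotient q (q ^ (m + 1)) := by
  have hnq : ‖-q‖ < 1 := by rwa [norm_neg]
  have hqm : ‖q ^ (m + 1)‖ < 1 := by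
    rw [norm_pow]; exact pow_lt_one₀ (norm_nonneg _) hq (by omega)
  rw [tsum_eq_sum (s := range (m + 1)), sum_congr rfl fun n _ => heckeTerm_pow_succ hq0 hq m n,
    ← mul_sum, eq_inv_of_mul_eq_one_right (sum_finiteTheta_eq hq0 hq m), thetaQuotient,
    qShiftedInf_eq_mul q hq m, qShiftedInf_eq_mul (-q) hq m, ← pow_succ', neg_mul, ← pow_succ']
  · have h1 := qShifted_ne_zero hnq hq m
    have h2 := qShiftedInf_ne_zero hqm hq
    have h3 : qShiftedInf (-q ^ (m + 1)) q ≠ 0 := qShiftedInf_ne_zero (by rwa [norm_neg]) hq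
    field_simp
  · intro n hn
    rw [heckeTerm_pow_succ hq0 hq, invQFactorial_of_neg q (show (m : ℤ) - n < 0 by
      have : m + 1 ≤ n := by simpa using hn
      omega)]
    simp

theorem hasSum_heckeTerm {q : ℂ} (hq0 : q ≠ 0) (hq : ‖q‖ < 1) {a : ℂ} (ha : ‖a‖ < 1) :
    HasSum (fun n => heckeTerm q n a) (thetaQuotient q a) := by
  have hnq : ‖-q‖ < 1 := by rwa [norm_neg]
  have hd : DifferentiableOn ℂ (thetaQuotient q) (Metric.ball 0 1) := by
    have h1 := differentiableOn_qShiftedInf hq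
    have h2 : DifferentiableOn ℂ (fun a => qShiftedInf (-a) q) (Metric.ball 0 1) :=
      h1.comp (differentiableOn_neg _) fun a ha => by simpa using ha
    exact ((differentiableOn_const _).mul h2).div ((h1.pow 2).mul (differentiableOn_const _))
      fun a ha => mul_ne_zero (pow_ne_zero _ (qShiftedInf_ne_zero (mem_ball_zero_iff.mp ha) hq))
        (qShiftedInf_ne_zero hnq hq)
  -- The points q^(m+1) are nonzero and tend to 0, an interior point of the disc.
  have hfreq : ∃ᶠ z in 𝓝[≠] (0 : ℂ), ∑' n, heckeTerm q n z = thetaQuotient q z := by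
    have ht : Tendsto (fun m : ℕ => q ^ (m + 1)) atTop (𝓝[≠] (0 : ℂ)) :=
      tendsto_nhdsWithin_iff.mpr ⟨(tendsto_add_atTop_iff_nat 1).mpr
        (tendsto_pow_atTop_nhds_zero_of_norm_lt_one hq),
        Eventually.of_forall fun m => pow_ne_zero _ hq0⟩
    exact ht.frequently (Frequently.of_forall fun m => tsum_heckeTerm_pow_succ hq0 hq m)
  have h := ((differentiableOn_tsum_heckeTerm hq).analyticOnNhd
    Metric.isOpen_ball).eqOn_of_preconnected_of_frequently_eq
    (hd.analyticOnNhd Metric.isOpen_ball) (convex_ball (0 : ℂ) 1).isPreconnected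
    (Metric.mem_ball_self one_pos) hfreq
  rw [← h (mem_ball_zero_iff.mpr ha)]
  exact (summable_heckeTerm ha hq).hasSum

/-! ### The Jacobi triple product -/

theorem tendsto_invQFactorial {q : ℂ} (hq : ‖q‖ < 1) :
    Tendsto (invQFactorial q) atTop (𝓝 (qShiftedInf q q)⁻¹) := by
  have h1 : Tendsto Int.toNat atTop atTop :=
    tendsto_atTop_atTop.mpr fun b => ⟨b, fun a ha => by omega⟩
  refine (((tendsto_qShifted q hq).inv₀ (qShiftedInf_ne_zero hq hq)).comp h1).congr' ?_
  filter_upwards [eventually_ge_atTop 0] with n hn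
  simp [invQFactorial, hn]

theorem norm_invQFactorial_le {q : ℂ} (hq : ‖q‖ < 1) (n : ℤ) :
    ‖invQFactorial q n‖ ≤ Real.exp ((1 - ‖q‖)⁻¹ * (1 - ‖q‖)⁻¹) := by
  rw [invQFactorial]
  split_ifs
  · exact norm_inv_qShifted_le hq le_rfl hq _
  · rw [norm_zero]; positivity

/-- Pull zq^(-i) out of each factor 1 + zq^(-i), for 0 ≤ i < N, leaving 1 + z⁻¹q^i. -/
theorem qShifted_reflect {q z : ℂ} (hq0 : q ≠ 0) (hz : z ≠ 0) (N : ℕ) :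
    qShifted (-(z * q * (q ^ N)⁻¹)) q N * q ^ N.choose 2 = z ^ N * qShifted (-z⁻¹) q N := by
  induction N with
  | zero => simp [qShifted_zero]
  | succ N ih =>
    have hN : q ^ N ≠ 0 := pow_ne_zero _ hq0
    rw [qShifted_succ', show -(z * q * (q ^ (N + 1))⁻¹) * q = -(z * q * (q ^ N)⁻¹) by
        rw [pow_succ]
        field_simp, choose_two_succ, pow_add, qShifted_succ]
    calc _ = (1 - -(z * q * (q ^ (N + 1))⁻¹)) * q ^ N *
          (qShifted (-(z * q * (q ^ N)⁻¹)) q N * q ^ N.choose 2) := by ring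
      _ = _ := by
        rw [ih, pow_succ, pow_succ]
        field_simp
        ring

theorem two_mul_triangle (j : ℤ) : 2 * (j * (j + 1) / 2) = j * (j + 1) :=
  Int.mul_ediv_cancel' (Int.even_mul_succ_self j).two_dvd

theorem two_mul_choose_two (s : ℕ) : 2 * ((s.choose 2 : ℕ) : ℤ) = s * (s - 1) := by
  induction s with
  | zero => simp
  | succ s ih => rw [choose_two_succ]; push_cast; linarith

/-- A finite form of the Jacobi triple product identity. -/
theorem finite_jacobi_triple_product {q z : ℂ} (hq0 : q ≠ 0) (hq : ‖q‖ < 1) (hz : z ≠ 0) (N : ℕ) :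
    ∑' j : ℤ, invQFactorial q (N + j) * invQFactorial q (N - j) *
      (z ^ j * q ^ (j * (j + 1) / 2)) =
    invQFactorial q ((2 * N : ℕ) : ℤ) * qShifted (-(z * q)) q N * qShifted (-z⁻¹) q N := by
  have hN : q ^ N ≠ 0 := pow_ne_zero _ hq0
  -- Centring the q-binomial sum of length 2N at s = N: the upper half of the product gives
  -- (-zq;q)_N, and the lower half is reflected into (-z⁻¹;q)_N.
  have hb := q_binomial hq (-(z * q * (q ^ N)⁻¹)) (2 * N)
  have hr := qShifted_reflect hq0 hz N
  rw [two_mul N, qShifted_add, ← two_mul,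
    show -(z * q * (q ^ N)⁻¹) * q ^ N = -(z * q) by field_simp] at hb
  have hc : q ^ N.choose 2 ≠ 0 := pow_ne_zero _ hq0
  have hzN : z ^ N ≠ 0 := pow_ne_zero _ hz
  rw [← (Equiv.subRight (N : ℤ)).tsum_eq,
    tsum_eq_sum (s := (range (2 * N + 1)).map Nat.castEmbedding), sum_map]
  · refine mul_left_cancel₀ hzN ?_
    calc _ = q ^ N.choose 2 * ∑ s ∈ range (2 * N + 1), invQFactorial q s *
          invQFactorial q (((2 * N : ℕ) : ℤ) - s) *
          ((- -(z * q * (q ^ N)⁻¹)) ^ s * q ^ s.choose 2) := by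
          rw [mul_sum, mul_sum]
          refine sum_congr rfl fun s _ => ?_
          simp only [Nat.castEmbedding_apply, Equiv.subRight_apply, neg_neg]
          rw [show (N : ℤ) + (s - N) = s by ring,
            show (N : ℤ) - (s - N) = ((2 * N : ℕ) : ℤ) - s by push_cast; ring]
          have e : z ^ N * (z ^ ((s : ℤ) - N) * q ^ (((s : ℤ) - N) * (s - N + 1) / 2)) =
              q ^ N.choose 2 * ((z * q * (q ^ N)⁻¹) ^ s * q ^ s.choose 2) := by
            have e1 : (z * q * (q ^ N)⁻¹) ^ s = z ^ s * q ^ ((s : ℤ) - N * s) := by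
              rw [mul_pow, mul_pow, inv_pow, ← pow_mul, zpow_sub₀ hq0, zpow_natCast,
                ← Nat.cast_mul, zpow_natCast, div_eq_mul_inv, mul_assoc]
            rw [e1, zpow_sub₀ hz, zpow_natCast, zpow_natCast,
              show ((s : ℤ) - N) * (s - N + 1) / 2 =
                ((N.choose 2 : ℕ) : ℤ) + ((s : ℤ) - N * s) + ((s.choose 2 : ℕ) : ℤ) by
                have h1 := two_mul_triangle ((s : ℤ) - N)
                have h2 := two_mul_choose_two N
                have h3 := two_mul_choose_two s
                linarith, zpow_add₀ hq0, zpow_add₀ hq0, zpow_natCast, zpow_natCast]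
            field_simp
          linear_combination invQFactorial q s * invQFactorial q (((2 * N : ℕ) : ℤ) - s) * e
      _ = _ := by
          rw [hb]
          linear_combination qShifted (-(z * q)) q N * invQFactorial q ((2 * N : ℕ) : ℤ) * hr
  · intro j hj
    rw [Equiv.subRight_apply]
    by_cases h : 0 ≤ j
    · lift j to ℕ using h
      have : ¬ j < 2 * N + 1 := by
        intro h
        exact hj (mem_map.mpr ⟨j, mem_range.mpr h, rfl⟩)
      rw [invQFactorial_of_neg q (show (N : ℤ) - (j - N) < 0 by omega)]
      simp
    · rw [invQFactorial_of_neg q (show (N : ℤ) + (j - N) < 0 by omega)]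
      simp

/-- The Jacobi triple product identity. -/
theorem jacobi_triple_product {q z : ℂ} (hq0 : q ≠ 0) (hq : ‖q‖ < 1) (hz : z ≠ 0)
    (hs : Summable fun j : ℤ => z ^ j * q ^ (j * (j + 1) / 2)) :
    ∑' j : ℤ, z ^ j * q ^ (j * (j + 1) / 2) =
      qShiftedInf q q * qShiftedInf (-(z * q)) q * qShiftedInf (-z⁻¹) q := by
  set C := Real.exp ((1 - ‖q‖)⁻¹ * (1 - ‖q‖)⁻¹)
  have h0 := qShiftedInf_ne_zero hq hq
  have hl : ∀ j : ℤ, Tendsto (fun N : ℕ => invQFactorial q (N + j)) atTop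
      (𝓝 (qShiftedInf q q)⁻¹) := fun j =>
    (tendsto_invQFactorial hq).comp
      (tendsto_atTop_add_const_right _ _ tendsto_natCast_atTop_atTop)
  have h1 : Tendsto (fun N : ℕ => ∑' j : ℤ, invQFactorial q (N + j) * invQFactorial q (N - j) *
      (z ^ j * q ^ (j * (j + 1) / 2))) atTop
      (𝓝 (∑' j : ℤ, (qShiftedInf q q)⁻¹ * (qShiftedInf q q)⁻¹ *
        (z ^ j * q ^ (j * (j + 1) / 2)))) := by
    -- The reciprocals 1/(q;q)_n are bounded uniformly in n, so the theta series itself dominates.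
    refine tendsto_tsum_of_dominated_convergence
      (bound := fun j => C * C * ‖z ^ j * q ^ (j * (j + 1) / 2)‖) (hs.norm.mul_left _)
      (fun j => ((hl j).mul (hl (-j))).mul_const _) (Eventually.of_forall fun N j => ?_)
    rw [norm_mul, norm_mul]
    have b1 := norm_invQFactorial_le hq (N + j)
    have b2 := norm_invQFactorial_le hq (N - j)
    gcongr
  have h2 : Tendsto (fun N : ℕ => invQFactorial q ((2 * N : ℕ) : ℤ) * qShifted (-(z * q)) q N *
      qShifted (-z⁻¹) q N) atTop
      (𝓝 ((qShiftedInf q q)⁻¹ * qShiftedInf (-(z * q)) q * qShiftedInf (-z⁻¹) q)) := by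
    refine (Tendsto.mul ?_ (tendsto_qShifted _ hq)).mul (tendsto_qShifted _ hq)
    refine (tendsto_invQFactorial hq).comp (tendsto_natCast_atTop_atTop.comp ?_)
    exact tendsto_id.const_mul_atTop' two_pos
  have h3 := tendsto_nhds_unique
    (h1.congr fun N => finite_jacobi_triple_product hq0 hq hz N) h2
  rw [tsum_mul_left] at h3
  field_simp at h3
  rw [h3, one_div]

/-! ### Product forms of φ and ψ -/

theorem ramanujanPhi_eq {q : ℂ} (hq0 : q ≠ 0) (hq : ‖q‖ < 1) :
    ramanujanPhi q = qShiftedInf (q ^ 2) (q ^ 2) * qShiftedInf (-q) (q ^ 2) ^ 2 := by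
  have hf : (fun j : ℤ => q⁻¹ ^ j * (q ^ 2) ^ (j * (j + 1) / 2)) = fun n : ℤ => q ^ (n ^ 2) := by
    funext j
    rw [← zpow_natCast q 2, ← zpow_mul, inv_zpow', ← zpow_add₀ hq0, Nat.cast_two,
      two_mul_triangle]
    congr 1
    ring
  -- Base q² and z = q⁻¹ turn the exponent into j(j+1) - j = j².
  have h := jacobi_triple_product (pow_ne_zero 2 hq0) (norm_sq_lt_one hq) (inv_ne_zero hq0)
    (by rw [hf]; exact summable_ramanujanPhi q hq)
  rw [hf] at h
  rw [ramanujanPhi, h, inv_inv, show q⁻¹ * q ^ 2 = q by field_simp]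
  ring

theorem ramanujanPsi_eq {q : ℂ} (hq0 : q ≠ 0) (hq : ‖q‖ < 1) :
    ramanujanPsi q = qShiftedInf q q * qShiftedInf (-q) q ^ 2 := by
  have hs := summable_ramanujanPsi q hq
  have hf1 : (fun n : ℕ => (1 : ℂ) ^ (n : ℤ) * q ^ ((n : ℤ) * (n + 1) / 2)) =
      fun n => q ^ (n * (n + 1) / 2) := by
    funext n
    rw [one_zpow, one_mul, ← zpow_natCast]
    push_cast
    rfl
  have hf2 : (fun n : ℕ => (1 : ℂ) ^ (-((n : ℤ) + 1)) *
      q ^ (-((n : ℤ) + 1) * (-((n : ℤ) + 1) + 1) / 2)) = fun n => q ^ (n * (n + 1) / 2) := by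
    funext n
    rw [one_zpow, one_mul, ← zpow_natCast,
      show -((n : ℤ) + 1) * (-((n : ℤ) + 1) + 1) = n * (n + 1) by ring]
    push_cast
    rfl
  have hsum := HasSum.of_nat_of_neg_add_one
    (f := fun j : ℤ => (1 : ℂ) ^ j * q ^ (j * (j + 1) / 2))
    (by rw [hf1]; exact hs.hasSum) (by rw [hf2]; exact hs.hasSum)
  -- At z = 1 the symmetry j ↦ -1 - j makes the bilateral sum 2ψ(q); the matching 2 on the right is
  -- the first factor of (-1;q)_∞.
  have h := jacobi_triple_product hq0 hq one_ne_zero hsum.summable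
  rw [hsum.tsum_eq, inv_one, one_mul, qShiftedInf_eq_mul (-1) hq 1] at h
  simp only [qShifted, range_one, prod_singleton, pow_zero, pow_one, neg_mul, one_mul,
    sub_neg_eq_add] at h
  rw [ramanujanPsi]
  linear_combination h / 2

theorem ramanujanPhi_mul_ramanujanPsi {q : ℂ} (hq0 : q ≠ 0) (hq : ‖q‖ < 1) :
    ramanujanPhi q * ramanujanPsi q = thetaQuotient (q ^ 2) q := by
  have hq2 := norm_sq_lt_one hq
  have h1 : qShiftedInf q (q ^ 2) ≠ 0 := qShiftedInf_ne_zero hq hq2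
  have h2 : qShiftedInf (-q ^ 2) (q ^ 2) ≠ 0 := qShiftedInf_ne_zero (by rwa [norm_neg]) hq2
  have h3 := euler_identity hq
  have h4 := qShiftedInf_mul_neg q hq
  have h5 := qShiftedInf_even_odd (-q) hq
  rw [neg_mul, ← sq] at h5
  rw [ramanujanPhi_eq hq0 hq, ramanujanPsi_eq hq0 hq, thetaQuotient,
    eq_div_iff (mul_ne_zero (pow_ne_zero 2 h1) h2), ← h4]
  calc _ = qShiftedInf q q ^ 2 * qShiftedInf (-q) q ^ 2 * qShiftedInf (-q) (q ^ 2) *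
        (qShiftedInf (-q) (q ^ 2) * qShiftedInf (-q ^ 2) (q ^ 2)) * qShiftedInf (-q) q *
        qShiftedInf q (q ^ 2) ^ 2 := by ring
    _ = qShiftedInf q q ^ 2 * qShiftedInf (-q) q ^ 2 * qShiftedInf (-q) (q ^ 2) *
        (qShiftedInf (-q) q * qShiftedInf q (q ^ 2)) ^ 2 := by rw [h5]; ring
    _ = _ := by rw [h3]; ring

/-- Since q - q^(2k+2) = q(1 - q^(2k+1)), the quotient collapses to q^n / (1 - q^(2n+1)), whose
denominator divides 1 - q^(4n+2). -/
theorem qNumer_sq_base_div {q : ℂ} (hq : ‖q‖ < 1) (n : ℕ) :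
    (1 - (q ^ 2) ^ (2 * n + 1)) * (qNumer q (q ^ 2) n / qShifted q (q ^ 2) (n + 1)) =
      (1 + q ^ (2 * n + 1)) * q ^ n := by
  have h1 : qNumer q (q ^ 2) n = q ^ n * qShifted q (q ^ 2) n := by
    rw [qNumer, qShifted, show q ^ n = ∏ _k ∈ range n, q by simp, ← prod_mul_distrib]
    refine prod_congr rfl fun k _ => ?_
    ring
  have h2 : qShifted q (q ^ 2) n ≠ 0 := qShifted_ne_zero hq (norm_sq_lt_one hq) n
  have h3 := one_sub_mul_pow_ne_zero hq (norm_sq_lt_one hq) n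
  rw [h1, qShifted_succ]
  field_simp
  ring

/-! ### The three expansions -/

theorem mainTheorem8 (q : ℂ) (hq0 : q ≠ 0) (hq1 : ‖q‖ < 1) :
    (∀ a : ℂ, ‖a‖ < 1 →
      HasSum
        (fun n : ℕ => ∑ j ∈ Finset.Icc (-(n : ℤ)) (n : ℤ),
          (-1 : ℂ) ^ ((n : ℤ) + j) * (1 - q ^ (2 * n + 1)) * q ^ ((n : ℤ) ^ 2 - j ^ 2) *
            (qNumer a q n / qShifted a q (n + 1)))
        (qShiftedInf q q ^ 2 * qShiftedInf (-a) q /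
          (qShiftedInf a q ^ 2 * qShiftedInf (-q) q))) ∧
    HasSum
      (fun n : ℕ => ∑ j ∈ Finset.Icc (-(n : ℤ)) (n : ℤ),
        (-1 : ℂ) ^ j * (1 - q ^ (2 * n + 1)) * q ^ ((3 * (n : ℤ) ^ 2 + n) / 2 - j ^ 2))
      (qShiftedInf q q ^ 2 * qShiftedInf q (q ^ 2)) ∧
    HasSum
      (fun n : ℕ => ∑ j ∈ Finset.Icc (-(n : ℤ)) (n : ℤ),
        (-1 : ℂ) ^ ((n : ℤ) + j) * (1 + q ^ (2 * n + 1)) *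
          q ^ (2 * (n : ℤ) ^ 2 + n - 2 * j ^ 2))
      (ramanujanPhi q * ramanujanPsi q) := by
  refine ⟨fun a ha => ?_, ?_, ?_⟩
  · refine (hasSum_heckeTerm hq0 hq1 ha).congr_fun ?_
    intro n
    rw [heckeTerm, heckeCoeff, sum_mul]
  -- At a = 0 the numerator is (-1)^n q^(n(n+1)/2): its sign cancels the (-1)^n of the coefficient,
  -- and its exponent adds to n² to give (3n² + n)/2.
  · have h := hasSum_heckeTerm hq0 hq1 (a := 0) (by simp)
    have hv : thetaQuotient q 0 = qShiftedInf q q ^ 2 * qShiftedInf q (q ^ 2) := by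
      rw [thetaQuotient, neg_zero, show qShiftedInf 0 q = 1 by simp [qShiftedInf],
        eq_inv_of_mul_eq_one_right (euler_identity hq1)]
      ring
    rw [hv] at h
    refine h.congr_fun fun n => ?_
    rw [heckeTerm, heckeCoeff, sum_mul, qNumer_zero,
      show qShifted 0 q (n + 1) = 1 by simp [qShifted], div_one]
    refine sum_congr rfl fun j _ => ?_
    have e : (3 * (n : ℤ) ^ 2 + n) / 2 - j ^ 2 =
        ((n : ℤ) ^ 2 - j ^ 2) + ((n * (n + 1) / 2 : ℕ) : ℤ) := by
      have : 2 * ((n : ℤ) * (n + 1) / 2) = (n : ℤ) ^ 2 + n := by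
        rw [two_mul_triangle]; ring
      push_cast
      omega
    have h5 : ((-1 : ℂ) ^ n) * (-1) ^ n = 1 := by rw [← mul_pow]; norm_num
    rw [e, zpow_add₀ hq0, zpow_natCast, zpow_add₀ (by norm_num), zpow_natCast]
    linear_combination (-(-1 : ℂ) ^ j * (1 - q ^ (2 * n + 1)) * q ^ ((n : ℤ) ^ 2 - j ^ 2) *
      q ^ (n * (n + 1) / 2)) * h5
  · have h := hasSum_heckeTerm (pow_ne_zero 2 hq0) (norm_sq_lt_one hq1) hq1
    rw [← ramanujanPhi_mul_ramanujanPsi hq0 hq1] at h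
    refine h.congr_fun fun n => ?_
    rw [heckeTerm, heckeCoeff, sum_mul]
    refine sum_congr rfl fun j _ => ?_
    have e : q ^ (2 * (n : ℤ) ^ 2 + n - 2 * j ^ 2) =
        (q ^ 2) ^ ((n : ℤ) ^ 2 - j ^ 2) * q ^ n := by
      rw [← zpow_natCast q 2, ← zpow_mul, ← zpow_natCast q n, ← zpow_add₀ hq0]
      congr 1
      push_cast
      ring
    rw [e]
    linear_combination (-(-1 : ℂ) ^ ((n : ℤ) + j) * (q ^ 2) ^ ((n : ℤ) ^ 2 - j ^ 2)) *
      qNumer_sq_base_div hq1 n
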